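/- Conventions. Let $X$ be a metric space. A family $\mathcal U$ of subsets of $X$ is \emph{uniformly bounded} if there is $M>0$ such that every member of $\mathcal U$ has diameter at most $M$. A map $f:X\to Y$ between metric spaces is \emph{ls-continuous} if $f(\mathcal U)=\{f(U)\mid U\in\mathcal U\}$ is uniformly bounded for every uniformly bounded family $\mathcal U$ in $X$; it is a \emph{coarse map} if moreover inverse images of bounded sets are bounded. Two maps $f,g:X\to Y$ are \emph{close} if the family $\{\{f(x),g(x)\}\mid x\in X\}$ is uniformly bounded. An ls-continuous map $f:X\to Y$ is a \emph{coarse embedding} if $\{f^{-1}(U)\mid U\in\mathcal U\}$ is uniformly bounded for every uniformly bounded family $\mathcal U$ in $Y$; it is a \emph{coarse equivalence} if there is an ls-continuous map $f':Y\to X$ such that $ff'$ and $f'f$ are close to the identities. A map $f:X\to Y$ is \emph{coarsely surjective} if there is a uniformly bounded family $\mathcal U$ in $Y$ such that $Y$ is the union of those members of $\mathcal U$ that meet $f(X)$. A bounded function $g:X\to\mathbb C$ is \emph{slowly oscillating} if for all $R,\varepsilon>0$ there is a bounded set $B\subseteq X$ such that $d(x,x')\le R$ implies $|g(x)-g(x')|\le\varepsilon$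 for all $x,x'\in X\setminus B$. Let $B_h(X)$ be the algebra of bounded slowly oscillating functions $X\to\mathbb C$, $C_h(X)$ the algebra of the continuous ones with the supremum norm, and $B_0(X)$, $C_0(X)$ their ideals of functions that tend to zero at infinity. The inclusion $C_h(X)\subseteq B_h(X)$ induces an isomorphism $C_h(X)/C_0(X)\cong B_h(X)/B_0(X)$. For a proper metric space $X$, the \emph{Higson compactification} $hX$ is the Gelfand spectrum of $C_h(X)$ (its space of characters with the weak-$*$ topology), which contains $X$ as the set of point evaluations, and the \emph{Higson corona} is $\nu X=hX\setminus X$. The points of $\nu X$ are exactly the characters of $C_h(X)/C_0(X)\cong B_h(X)/B_0(X)$. A coarse map $f:X\to Y$ between proper metric spaces induces the homomorphism $f^*:B_h(Y)/B_0(Y)\to B_h(X)/B_0(X)$, $[g]\mapsto[g\circ f]$, and hence, by composing characters with $f^*$, a continuous map $\nu f:\nu X\to\nu Y$. Proposition. Let $X$ and $Y$ be proper metric spaces, with $X$ non-empty unless $Y$ is empty, let $f:X\to Y$ be a coarse map and let $\nu f:\nu X\to\nu Y$ be the induced continuous map between Higson coronas. Then (1) $\nu f$ is injective if and only if $f$ is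 a coarse embedding; (2) $\nu f$ is surjective if and only if $f$ is coarsely surjective; (3) $\nu f$ is a homeomorphism if and only if $f$ is a coarse equivalence. -/

import Mathlib

open Set Filter Topology Bornology
open scoped BoundedContinuousFunction

noncomputable section

namespace LargeScale

variable {X Y : Type*}

/-! ### The large scale structure of a metric space and coarse maps -/

/-- The uniformly bounded families of subsets of a metric space: the diameters of the members of
the family have a common finite bound. -/
def UniformlyBounded [MetricSpace X] (𝒰 : Set (Set X)) : Prop :=
  ∃ M : ℝ, 0 < M ∧ ∀ U ∈ 𝒰, ∀ x ∈ U, ∀ y ∈ U, dist x y ≤ M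

/-- The star of a set `B` with respect to a family `𝒰`: the union of the members of `𝒰` that
intersect `B`. -/
def starOf (B : Set X) (𝒰 : Set (Set X)) : Set X :=
  ⋃₀ {U ∈ 𝒰 | (U ∩ B).Nonempty}

/-- Images of uniformly bounded families are uniformly bounded. -/
def LSContinuous [MetricSpace X] [MetricSpace Y] (f : X → Y) : Prop :=
  ∀ 𝒰 : Set (Set X), UniformlyBounded 𝒰 → UniformlyBounded ((fun U => f '' U) '' 𝒰)

/-- A coarse map: large scale continuous, and inverse images of bounded sets are bounded. -/
structure IsCoarseMap [MetricSpace X] [MetricSpace Y] (f : X → Y) : Prop where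
  lsContinuous : LSContinuous f
  proper : ∀ B : Set Y, IsBounded B → IsBounded (f ⁻¹' B)

/-- Two maps are close if the family `{{f x, g x} | x}` is uniformly bounded. -/
def Close [MetricSpace Y] (f g : X → Y) : Prop :=
  UniformlyBounded (range fun x => ({f x, g x} : Set Y))

/-- `Y` is contained in the star of `f(X)` for some uniformly bounded family. -/
def CoarselySurjective [MetricSpace Y] (f : X → Y) : Prop :=
  ∃ 𝒰 : Set (Set Y), UniformlyBounded 𝒰 ∧ univ ⊆ starOf (range f) 𝒰

/-- A large scale continuous map such that inverse images of uniformly bounded families are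
uniformly bounded. -/
def IsCoarseEmbedding [MetricSpace X] [MetricSpace Y] (f : X → Y) : Prop :=
  LSContinuous f ∧
    ∀ 𝒰 : Set (Set Y), UniformlyBounded 𝒰 → UniformlyBounded ((fun U => f ⁻¹' U) '' 𝒰)

/-- A large scale continuous map with a large scale continuous inverse up to closeness. -/
def IsCoarseEquivalence [MetricSpace X] [MetricSpace Y] (f : X → Y) : Prop :=
  LSContinuous f ∧ ∃ f' : Y → X, LSContinuous f' ∧ Close (f ∘ f') id ∧ Close (f' ∘ f) id

/-! ### Slowly oscillating functions -/

/-- The oscillation of `g` at every fixed scale `R` tends to zero at infinity. -/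
def SlowlyOscillating [MetricSpace X] (g : X → ℂ) : Prop :=
  ∀ R > (0 : ℝ), ∀ ε > (0 : ℝ), ∃ B : Set X, IsBounded B ∧
    ∀ x ∉ B, ∀ x' ∉ B, dist x x' ≤ R → ‖g x - g x'‖ ≤ ε

/-- A function on a metric space that tends to zero at infinity. -/
def TendsToZero [MetricSpace X] (g : X → ℂ) : Prop :=
  ∀ ε > (0 : ℝ), ∃ B : Set X, IsBounded B ∧ ∀ x ∉ B, ‖g x‖ ≤ ε

section closure_properties

variable [MetricSpace X]

theorem SlowlyOscillating.const (c : ℂ) : SlowlyOscillating (fun _ : X => c) := by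
  intro R _ ε hε
  exact ⟨∅, isBounded_empty, fun x _ x' _ _ => by simpa using hε.le⟩

theorem SlowlyOscillating.add {g h : X → ℂ} (hg : SlowlyOscillating g)
    (hh : SlowlyOscillating h) : SlowlyOscillating (fun x => g x + h x) := by
  intro R hR ε hε
  obtain ⟨B, hB, h1⟩ := hg R hR (ε / 2) (by positivity)
  obtain ⟨C, hC, h2⟩ := hh R hR (ε / 2) (by positivity)
  refine ⟨B ∪ C, hB.union hC, fun x hx x' hx' hd => ?_⟩
  simp only [mem_union, not_or] at hx hx'
  have e1 := h1 x hx.1 x' hx'.1 hd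
  have e2 := h2 x hx.2 x' hx'.2 hd
  calc ‖g x + h x - (g x' + h x')‖ = ‖(g x - g x') + (h x - h x')‖ := by ring_nf
    _ ≤ ‖g x - g x'‖ + ‖h x - h x'‖ := norm_add_le _ _
    _ ≤ ε := by linarith

theorem SlowlyOscillating.mul {g h : X → ℂ} (hg : SlowlyOscillating g)
    (hh : SlowlyOscillating h) (bg : ∃ C, ∀ x, ‖g x‖ ≤ C) (bh : ∃ C, ∀ x, ‖h x‖ ≤ C) :
    SlowlyOscillating (fun x => g x * h x) := by
  intro R hR ε hε
  obtain ⟨C, hC⟩ := bg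
  obtain ⟨D, hD⟩ := bh
  have hK : 0 < |C| + |D| + 1 := by positivity
  obtain ⟨B, hB, h1⟩ := hg R hR (ε / (|C| + |D| + 1)) (by positivity)
  obtain ⟨B', hB', h2⟩ := hh R hR (ε / (|C| + |D| + 1)) (by positivity)
  refine ⟨B ∪ B', hB.union hB', fun x hx x' hx' hd => ?_⟩
  simp only [mem_union, not_or] at hx hx'
  have e1 := h1 x hx.1 x' hx'.1 hd
  have e2 := h2 x hx.2 x' hx'.2 hd
  have hη : 0 < ε / (|C| + |D| + 1) := by positivity
  have b1 : ‖g x‖ ≤ |C| := (hC x).trans (le_abs_self C)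
  have b2 : ‖h x'‖ ≤ |D| := (hD x').trans (le_abs_self D)
  calc ‖g x * h x - g x' * h x'‖ = ‖g x * (h x - h x') + (g x - g x') * h x'‖ := by ring_nf
    _ ≤ ‖g x‖ * ‖h x - h x'‖ + ‖g x - g x'‖ * ‖h x'‖ := by
        refine (norm_add_le _ _).trans ?_
        rw [norm_mul, norm_mul]
    _ ≤ |C| * (ε / (|C| + |D| + 1)) + (ε / (|C| + |D| + 1)) * |D| := by gcongr
    _ ≤ (|C| + |D| + 1) * (ε / (|C| + |D| + 1)) := by nlinarith
    _ = ε := by field_simp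

theorem SlowlyOscillating.conj {g : X → ℂ} (hg : SlowlyOscillating g) :
    SlowlyOscillating (fun x => Star.star (g x)) := by
  intro R hR ε hε
  obtain ⟨B, hB, h1⟩ := hg R hR ε hε
  refine ⟨B, hB, fun x hx x' hx' hd => ?_⟩
  rw [← star_sub, norm_star]
  exact h1 x hx x' hx' hd

theorem SlowlyOscillating.inv {g : X → ℂ} (hg : SlowlyOscillating g) {c : ℝ} (hc : 0 < c)
    (hcg : ∀ x, c ≤ ‖g x‖) : SlowlyOscillating (fun x => (g x)⁻¹) := by
  intro R hR ε hε
  obtain ⟨B, hB, h1⟩ := hg R hR (ε * (c * c)) (by positivity)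
  refine ⟨B, hB, fun x hx x' hx' hd => ?_⟩
  have n1 : g x ≠ 0 := norm_pos_iff.1 (hc.trans_le (hcg x))
  have n2 : g x' ≠ 0 := norm_pos_iff.1 (hc.trans_le (hcg x'))
  rw [inv_sub_inv n1 n2, norm_div, norm_mul, norm_sub_rev, div_le_iff₀ (by positivity)]
  refine (h1 x hx x' hx' hd).trans ?_
  have := hcg x
  have := hcg x'
  gcongr

theorem TendsToZero.slowlyOscillating {g : X → ℂ} (hg : TendsToZero g) :
    SlowlyOscillating g := by
  intro R hR ε hε
  obtain ⟨B, hB, h1⟩ := hg (ε / 2) (by positivity)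
  refine ⟨B, hB, fun x hx x' hx' _ => ?_⟩
  have := h1 x hx
  have := h1 x' hx'
  exact (norm_sub_le _ _).trans (by linarith)

theorem TendsToZero.zero : TendsToZero (fun _ : X => (0 : ℂ)) := by
  intro ε hε
  exact ⟨∅, isBounded_empty, fun x _ => by simpa using hε.le⟩

theorem TendsToZero.add {g h : X → ℂ} (hg : TendsToZero g) (hh : TendsToZero h) :
    TendsToZero (fun x => g x + h x) := by
  intro ε hε
  obtain ⟨B, hB, h1⟩ := hg (ε / 2) (by positivity)
  obtain ⟨C, hC, h2⟩ := hh (ε / 2) (by positivity)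
  refine ⟨B ∪ C, hB.union hC, fun x hx => ?_⟩
  simp only [mem_union, not_or] at hx
  have := h1 x hx.1
  have := h2 x hx.2
  exact (norm_add_le _ _).trans (by linarith)

theorem TendsToZero.bounded_mul {g h : X → ℂ} (hh : TendsToZero h)
    (bg : ∃ C, ∀ x, ‖g x‖ ≤ C) : TendsToZero (fun x => g x * h x) := by
  intro ε hε
  obtain ⟨C, hC⟩ := bg
  have hK : 0 < |C| + 1 := by positivity
  obtain ⟨B, hB, h1⟩ := hh (ε / (|C| + 1)) (by positivity)
  refine ⟨B, hB, fun x hx => ?_⟩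
  have b1 : ‖g x‖ ≤ |C| + 1 := (hC x).trans ((le_abs_self C).trans (by linarith))
  rw [norm_mul]
  calc ‖g x‖ * ‖h x‖ ≤ (|C| + 1) * (ε / (|C| + 1)) :=
        mul_le_mul b1 (h1 x hx) (norm_nonneg _) hK.le
    _ = ε := by field_simp

end closure_properties

/-! ### The algebras of slowly oscillating functions -/

/-- `B_h(X)`: the bounded slowly oscillating functions `X → ℂ`, not necessarily continuous. -/
def Bh (X : Type*) [MetricSpace X] : StarSubalgebra ℂ (X → ℂ) where
  carrier := {g | (∃ C : ℝ, ∀ x, ‖g x‖ ≤ C) ∧ SlowlyOscillating g}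
  mul_mem' := by
    rintro g h ⟨⟨C, hC⟩, hg⟩ ⟨⟨D, hD⟩, hh⟩
    refine ⟨⟨|C| * |D|, fun x => ?_⟩, hg.mul hh ⟨C, hC⟩ ⟨D, hD⟩⟩
    rw [Pi.mul_apply, norm_mul]
    exact mul_le_mul ((hC x).trans (le_abs_self C)) ((hD x).trans (le_abs_self D))
      (norm_nonneg _) (abs_nonneg _)
  add_mem' := by
    rintro g h ⟨⟨C, hC⟩, hg⟩ ⟨⟨D, hD⟩, hh⟩
    exact ⟨⟨C + D, fun x => (norm_add_le _ _).trans (add_le_add (hC x) (hD x))⟩, hg.add hh⟩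
  algebraMap_mem' := fun c => ⟨⟨‖c‖, fun x => by simp⟩, SlowlyOscillating.const c⟩
  star_mem' := by
    rintro g ⟨⟨C, hC⟩, hg⟩
    exact ⟨⟨C, fun x => by simpa using hC x⟩, hg.conj⟩

/-- `B_0(X)`: the ideal of `B_h(X)` of the functions that tend to zero at infinity. -/
def B0 (X : Type*) [MetricSpace X] : Ideal (Bh X) where
  carrier := {g | TendsToZero (g : X → ℂ)}
  add_mem' := fun hg hh => hg.add hh
  zero_mem' := TendsToZero.zero
  smul_mem' := fun c _ hg => hg.bounded_mul c.2.1

/-- `C_h(X)`: the algebra of bounded continuous slowly oscillating functions `X → ℂ`, with the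
supremum norm. -/
def Ch (X : Type*) [MetricSpace X] : StarSubalgebra ℂ (X →ᵇ ℂ) where
  carrier := {g | SlowlyOscillating (g : X → ℂ)}
  mul_mem' := fun {g h} hg hh =>
    hg.mul hh ⟨‖g‖, g.norm_coe_le_norm⟩ ⟨‖h‖, h.norm_coe_le_norm⟩
  add_mem' := fun hg hh => hg.add hh
  algebraMap_mem' := fun c => SlowlyOscillating.const c
  star_mem' := fun hg => hg.conj

/-- `C_0(X)`: the ideal of `C_h(X)` of the functions that tend to zero at infinity. -/
def C0 (X : Type*) [MetricSpace X] : Ideal (Ch X) where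
  carrier := {g | TendsToZero ((g : X →ᵇ ℂ) : X → ℂ)}
  add_mem' := fun hg hh => hg.add hh
  zero_mem' := TendsToZero.zero
  smul_mem' := fun c _ hg => hg.bounded_mul ⟨‖(c : X →ᵇ ℂ)‖, (c : X →ᵇ ℂ).norm_coe_le_norm⟩

theorem isClosed_Ch (X : Type*) [MetricSpace X] : IsClosed (Ch X : Set (X →ᵇ ℂ)) := by
  refine isClosed_of_closure_subset fun g hg => ?_
  intro R hR ε hε
  obtain ⟨h, hh, hd⟩ := Metric.mem_closure_iff.1 hg (ε / 3) (by positivity)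
  obtain ⟨B, hB, h1⟩ := hh R hR (ε / 3) (by positivity)
  refine ⟨B, hB, fun x hx x' hx' hxx => ?_⟩
  have e1 : ‖g x - h x‖ ≤ ε / 3 := by
    rw [← dist_eq_norm]; exact (BoundedContinuousFunction.dist_coe_le_dist x).trans hd.le
  have e2 : ‖h x' - g x'‖ ≤ ε / 3 := by
    rw [← dist_eq_norm, dist_comm]
    exact (BoundedContinuousFunction.dist_coe_le_dist x').trans hd.le
  have e3 := h1 x hx x' hx' hxx
  calc ‖g x - g x'‖ = ‖(g x - h x) + (h x - h x') + (h x' - g x')‖ := by ring_nf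
    _ ≤ ‖g x - h x‖ + ‖h x - h x'‖ + ‖h x' - g x'‖ := norm_add₃_le
    _ ≤ ε := by linarith

instance instCompleteSpaceCh (X : Type*) [MetricSpace X] : CompleteSpace (Ch X) :=
  (isClosed_Ch X).completeSpace_coe

/-! ### The Higson compactification and the Higson corona -/

/-- The Higson compactification `hX`: the Gelfand spectrum of `C_h(X)`, that is, the space of
characters of `C_h(X)` with the weak-* topology. -/
abbrev HigsonCompactification (X : Type*) [MetricSpace X] : Type _ :=
  WeakDual.characterSpace ℂ (Ch X)

/-- The character `g ↦ g x` of `C_h(X)`. -/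
def evalAlgHom [MetricSpace X] (x : X) : Ch X →ₐ[ℂ] ℂ where
  toFun g := (g : X →ᵇ ℂ) x
  map_one' := rfl
  map_mul' _ _ := rfl
  map_zero' := rfl
  map_add' _ _ := rfl
  commutes' _ := rfl

/-- The canonical map `X → hX`, which sends a point to the evaluation at that point. -/
def toHigson [MetricSpace X] (x : X) : HigsonCompactification X :=
  WeakDual.CharacterSpace.equivAlgHom.symm (evalAlgHom x)

theorem toHigson_apply [MetricSpace X] (x : X) (g : Ch X) :
    toHigson x g = (g : X →ᵇ ℂ) x := rfl

/-- The Higson corona `νX = hX \ X`. -/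
def HigsonCorona (X : Type*) [MetricSpace X] : Set (HigsonCompactification X) :=
  (range (toHigson : X → HigsonCompactification X))ᶜ

/-! ### The canonical isomorphism `C_h(X) / C_0(X) ≃ B_h(X) / B_0(X)` -/

/-- The inclusion `C_h(X) → B_h(X)`. -/
def inclusionHom (X : Type*) [MetricSpace X] : Ch X →ₐ[ℂ] Bh X where
  toFun g := ⟨(g : X →ᵇ ℂ), ⟨⟨‖(g : X →ᵇ ℂ)‖, (g : X →ᵇ ℂ).norm_coe_le_norm⟩, g.2⟩⟩
  map_one' := rfl
  map_mul' _ _ := rfl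
  map_zero' := rfl
  map_add' _ _ := rfl
  commutes' _ := rfl

/-- The map `C_h(X) / C_0(X) → B_h(X) / B_0(X)` induced by the inclusion. -/
def quotientInclusion (X : Type*) [MetricSpace X] : (Ch X ⧸ C0 X) →ₐ[ℂ] (Bh X ⧸ B0 X) :=
  Ideal.quotientMapₐ (B0 X) (inclusionHom X) (fun _ hg => hg)

/-- Every bounded slowly oscillating function is continuous up to a function that tends to zero
at infinity. -/
theorem exists_continuous_approx [MetricSpace X] (g : Bh X) :
    ∃ g' : Ch X, TendsToZero (fun x => (g' : X →ᵇ ℂ) x - (g : X → ℂ) x) := by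
  obtain ⟨g, ⟨C, hC⟩, hg⟩ := g
  obtain ⟨k, hk⟩ := exists_continuous_forall_mem_convex_of_local_const
    (t := fun x : X => convexHull ℝ (g '' Metric.closedBall x 1))
    (fun x => convex_convexHull ℝ _) (fun x => ⟨g x, by
      filter_upwards [Metric.closedBall_mem_nhds x one_pos] with y hy
      exact subset_convexHull ℝ _ ⟨x, by rwa [Metric.mem_closedBall'] , rfl⟩⟩)
  have key : ∀ x (z : ℂ) (r : ℝ), (∀ y, dist y x ≤ 1 → ‖g y - z‖ ≤ r) → ‖k x - z‖ ≤ r := by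
    intro x z r h
    have : convexHull ℝ (g '' Metric.closedBall x 1) ⊆ Metric.closedBall z r := by
      refine convexHull_min ?_ (convex_closedBall z r)
      rintro _ ⟨y, hy, rfl⟩
      rw [Metric.mem_closedBall, dist_eq_norm]
      exact h y hy
    have := this (hk x)
    rwa [Metric.mem_closedBall, dist_eq_norm] at this
  have hz : TendsToZero (fun x => k x - g x) := by
    intro ε hε
    obtain ⟨B, hB, h1⟩ := hg 1 one_pos ε hε
    refine ⟨Metric.cthickening 1 B, hB.cthickening, fun x hx => key x _ _ fun y hy => ?_⟩
    refine h1 y (fun hyB => hx ?_) x (fun hxB => hx ?_) hy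
    · exact Metric.mem_cthickening_of_dist_le x y 1 B hyB (by rwa [dist_comm])
    · exact Metric.self_subset_cthickening B hxB
  have hb : ∀ x, ‖k x‖ ≤ C := fun x => by
    simpa using key x 0 C (fun y _ => by simpa using hC y)
  have hs : SlowlyOscillating k := by
    have := hz.slowlyOscillating.add hg
    simpa using this
  exact ⟨⟨BoundedContinuousFunction.ofNormedAddCommGroup k k.continuous C hb, hs⟩, hz⟩

theorem quotientInclusion_bijective (X : Type*) [MetricSpace X] :
    Function.Bijective (quotientInclusion X) := by
  constructor
  · rw [injective_iff_map_eq_zero]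
    intro a ha
    obtain ⟨g, rfl⟩ := Ideal.Quotient.mk_surjective a
    rw [Ideal.Quotient.eq_zero_iff_mem]
    exact (Ideal.Quotient.eq_zero_iff_mem (I := B0 X) (a := inclusionHom X g)).1 ha
  · intro b
    obtain ⟨g, rfl⟩ := Ideal.Quotient.mk_surjective b
    obtain ⟨g', hg'⟩ := exists_continuous_approx g
    refine ⟨Ideal.Quotient.mk _ g', ?_⟩
    exact (Ideal.Quotient.eq (I := B0 X) (x := inclusionHom X g') (y := g)).2 hg'

/-- The canonical isomorphism `C_h(X) / C_0(X) ≃ B_h(X) / B_0(X)` induced by the inclusion. -/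
def quotientEquiv (X : Type*) [MetricSpace X] : (Ch X ⧸ C0 X) ≃ₐ[ℂ] (Bh X ⧸ B0 X) :=
  AlgEquiv.ofBijective (quotientInclusion X) (quotientInclusion_bijective X)

/-! ### Points of the corona are the characters of `C_h(X) / C_0(X)` -/

theorem isUnit_Ch_of_le [MetricSpace X] (g : Ch X) {c : ℝ} (hc : 0 < c)
    (h : ∀ x, c ≤ ‖(g : X →ᵇ ℂ) x‖) : IsUnit g := by
  have n : ∀ x, (g : X →ᵇ ℂ) x ≠ 0 := fun x => norm_pos_iff.1 (hc.trans_le (h x))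
  let k : X →ᵇ ℂ := BoundedContinuousFunction.ofNormedAddCommGroup
    (fun x => ((g : X →ᵇ ℂ) x)⁻¹) ((g : X →ᵇ ℂ).continuous.inv₀ n) c⁻¹ (fun x => by
      rw [norm_inv]; exact inv_anti₀ hc (h x))
  have hk : SlowlyOscillating (k : X → ℂ) := SlowlyOscillating.inv g.2 hc h
  refine IsUnit.of_mul_eq_one (⟨k, hk⟩ : Ch X) ?_
  apply Subtype.ext
  ext x
  exact mul_inv_cancel₀ (n x)

theorem corona_vanish [MetricSpace X] [ProperSpace X] (φ : HigsonCompactification X)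
    (hφ : φ ∈ HigsonCorona X) (h : Ch X) (hh : h ∈ C0 X) : φ h = 0 := by
  by_contra hne
  have hsep : ∀ x : X, ∃ a : Ch X, φ a = 0 ∧ (a : X →ᵇ ℂ) x ≠ 0 := by
    intro x
    have : φ ≠ toHigson x := fun e => hφ ⟨x, e.symm⟩
    obtain ⟨a, ha⟩ : ∃ a, φ a ≠ toHigson x a := by
      by_contra! hall
      exact this (WeakDual.CharacterSpace.ext hall)
    refine ⟨a - algebraMap ℂ (Ch X) (φ a), ?_, ?_⟩
    · rw [map_sub, AlgHomClass.commutes]; simp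
    · intro e
      apply ha
      have e' : (a : X →ᵇ ℂ) x - φ a = 0 := e
      rw [toHigson_apply]
      exact (sub_eq_zero.1 e').symm
  choose a ha0 hax using hsep
  have hpos : 0 < ‖φ h‖ / 2 := by positivity
  obtain ⟨B, hB, hBh⟩ := hh (‖φ h‖ / 2) hpos
  have hK : IsCompact (closure B) := hB.isCompact_closure
  obtain ⟨t, ht⟩ := hK.elim_finite_subcover
    (fun x : X => {y | ((a x : X →ᵇ ℂ)) y ≠ 0})
    (fun x => isOpen_ne_fun (a x : X →ᵇ ℂ).continuous continuous_const)
    (fun y _ => mem_iUnion.2 ⟨y, hax y⟩)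
  let d : Ch X := h - algebraMap ℂ (Ch X) (φ h)
  have hd : φ d = 0 := by
    change φ (h - algebraMap ℂ (Ch X) (φ h)) = 0
    rw [map_sub, AlgHomClass.commutes]; simp
  let s : Ch X := (∑ x ∈ t, Star.star (a x) * a x) + Star.star d * d
  have hs : φ s = 0 := by
    change φ ((∑ x ∈ t, Star.star (a x) * a x) + Star.star d * d) = 0
    rw [map_add, map_sum, map_mul, hd, mul_zero, add_zero]
    refine Finset.sum_eq_zero fun x _ => ?_
    rw [map_mul, ha0, mul_zero]
  let r : X → ℝ := fun y => (∑ x ∈ t, ‖(a x : X →ᵇ ℂ) y‖ ^ 2) + ‖(d : X →ᵇ ℂ) y‖ ^ 2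
  have hsr : ∀ y, (s : X →ᵇ ℂ) y = (r y : ℂ) := by
    intro y
    have e : (s : X →ᵇ ℂ) y = evalAlgHom y s := rfl
    have hev : ∀ b : Ch X, evalAlgHom y (Star.star b * b) =
        ((‖(b : X →ᵇ ℂ) y‖ ^ 2 : ℝ) : ℂ) := by
      intro b
      rw [map_mul]
      have := Complex.conj_mul' ((b : X →ᵇ ℂ) y)
      push_cast
      exact this
    rw [e]
    change evalAlgHom y ((∑ x ∈ t, Star.star (a x) * a x) + Star.star d * d) = _
    rw [map_add, map_sum, hev, Finset.sum_congr rfl (fun x _ => hev (a x))]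
    simp [r]
  have hr0 : ∀ y, 0 ≤ r y := fun y => by positivity
  have hrc : Continuous r := by
    refine Continuous.add (continuous_finsetSum _ fun x _ => ?_) ?_
    · exact ((a x : X →ᵇ ℂ).continuous.norm).pow 2
    · exact ((d : X →ᵇ ℂ).continuous.norm).pow 2
  obtain ⟨c, hc, hcr⟩ : ∃ c > 0, ∀ y ∈ closure B, c ≤ r y := by
    rcases (closure B).eq_empty_or_nonempty with he | hne'
    · exact ⟨1, one_pos, fun y hy => by simp [he] at hy⟩
    · obtain ⟨y0, hy0, hmin⟩ := hK.exists_isMinOn hne' hrc.continuousOn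
      refine ⟨r y0, ?_, fun y hy => hmin hy⟩
      obtain ⟨x, hx⟩ := mem_iUnion.1 (ht hy0)
      obtain ⟨hxt, hx⟩ := mem_iUnion.1 hx
      have hx' : 0 < ‖(a x : X →ᵇ ℂ) y0‖ ^ 2 := pow_pos (norm_pos_iff.2 hx) 2
      have := Finset.single_le_sum (f := fun x => ‖(a x : X →ᵇ ℂ) y0‖ ^ 2)
        (fun i _ => by positivity) hxt
      have h2 : 0 ≤ ‖(d : X →ᵇ ℂ) y0‖ ^ 2 := by positivity
      simp only [r]
      linarith
  have hout : ∀ y ∉ closure B, (‖φ h‖ / 2) ^ 2 ≤ r y := by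
    intro y hy
    have e1 := hBh y (fun hyB => hy (subset_closure hyB))
    have e2 : (d : X →ᵇ ℂ) y = (h : X →ᵇ ℂ) y - φ h := rfl
    have e3 : ‖φ h‖ / 2 ≤ ‖(d : X →ᵇ ℂ) y‖ := by
      rw [e2, norm_sub_rev]
      have := norm_sub_norm_le (φ h) ((h : X →ᵇ ℂ) y)
      linarith
    have e4 : (‖φ h‖ / 2) ^ 2 ≤ ‖(d : X →ᵇ ℂ) y‖ ^ 2 := by gcongr
    have e5 : 0 ≤ ∑ x ∈ t, ‖(a x : X →ᵇ ℂ) y‖ ^ 2 := by positivity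
    simp only [r]
    linarith
  have hu : IsUnit s := by
    refine isUnit_Ch_of_le s (c := min c ((‖φ h‖ / 2) ^ 2)) (lt_min hc (by positivity)) fun y => ?_
    rw [hsr, Complex.norm_real, Real.norm_of_nonneg (hr0 y)]
    by_cases hy : y ∈ closure B
    · exact (min_le_left _ _).trans (hcr y hy)
    · exact (min_le_right _ _).trans (hout y hy)
  have := hu.map φ
  rw [hs] at this
  exact not_isUnit_zero this

theorem mem_corona_of_vanish [MetricSpace X] (φ : HigsonCompactification X)
    (h : ∀ g ∈ C0 X, φ g = 0) : φ ∈ HigsonCorona X := by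
  rintro ⟨x, rfl⟩
  let k : X →ᵇ ℂ := BoundedContinuousFunction.ofNormedAddCommGroup
    (fun y => ((max 0 (1 - dist y x) : ℝ) : ℂ)) (by fun_prop) 1 (fun y => by
      rw [Complex.norm_real, Real.norm_of_nonneg (le_max_left _ _)]
      exact max_le zero_le_one (by linarith [dist_nonneg (x := y) (y := x)]))
  have hk : TendsToZero (k : X → ℂ) := by
    intro ε hε
    refine ⟨Metric.closedBall x 1, Metric.isBounded_closedBall, fun y hy => ?_⟩
    have hy' : 1 < dist y x := by simpa using hy
    have : (k : X → ℂ) y = 0 := by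
      change ((max 0 (1 - dist y x) : ℝ) : ℂ) = 0
      rw [max_eq_left (by linarith)]; simp
    rw [this]; simpa using hε.le
  have e := h (⟨k, hk.slowlyOscillating⟩ : Ch X) hk
  rw [toHigson_apply] at e
  have e' : ((max 0 (1 - dist x x) : ℝ) : ℂ) = 0 := e
  simp at e'

/-- The character of `C_h(X) / C_0(X)` that corresponds to a point of the corona. -/
def coronaToCharacter [MetricSpace X] [ProperSpace X] (φ : HigsonCorona X) :
    (Ch X ⧸ C0 X) →ₐ[ℂ] ℂ :=
  Ideal.Quotient.liftₐ (C0 X) (WeakDual.CharacterSpace.toAlgHom φ.1)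
    (fun g hg => corona_vanish φ.1 φ.2 g hg)

/-- The point of the corona that corresponds to a character of `C_h(X) / C_0(X)`. -/
def characterToCorona [MetricSpace X] (χ : (Ch X ⧸ C0 X) →ₐ[ℂ] ℂ) : HigsonCorona X :=
  ⟨WeakDual.CharacterSpace.equivAlgHom.symm (χ.comp (Ideal.Quotient.mkₐ ℂ (C0 X))),
    mem_corona_of_vanish _ fun g hg => by
      change χ (Ideal.Quotient.mk (C0 X) g) = 0
      rw [Ideal.Quotient.eq_zero_iff_mem.2 hg, map_zero]⟩

/-- The points of `νX` are exactly the characters of `C_h(X) / C_0(X)`. -/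
def coronaEquiv (X : Type*) [MetricSpace X] [ProperSpace X] :
    HigsonCorona X ≃ ((Ch X ⧸ C0 X) →ₐ[ℂ] ℂ) where
  toFun := coronaToCharacter
  invFun := characterToCorona
  left_inv φ := by
    apply Subtype.ext
    apply WeakDual.CharacterSpace.ext
    intro g
    rfl
  right_inv χ := by
    ext a
    obtain ⟨g, rfl⟩ := Ideal.Quotient.mk_surjective a
    rfl

/-! ### The map of coronas induced by a coarse map -/

theorem IsCoarseMap.slowlyOscillating_comp [MetricSpace X] [MetricSpace Y] {f : X → Y}
    (hf : IsCoarseMap f) {g : Y → ℂ} (hg : SlowlyOscillating g) :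
    SlowlyOscillating (g ∘ f) := by
  intro R hR ε hε
  obtain ⟨M, hM, hfM⟩ := hf.lsContinuous {U | ∀ x ∈ U, ∀ y ∈ U, dist x y ≤ R}
    ⟨R, hR, fun _ hU => hU⟩
  obtain ⟨B, hB, h1⟩ := hg M hM ε hε
  refine ⟨f ⁻¹' B, hf.proper B hB, fun x hx x' hx' hd => h1 _ hx _ hx' ?_⟩
  refine hfM (f '' {x, x'}) ⟨{x, x'}, ?_, rfl⟩ _ ⟨x, by simp, rfl⟩ _ ⟨x', by simp, rfl⟩
  rintro a (rfl | rfl) b (rfl | rfl)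
  · simpa using hR.le
  · exact hd
  · rwa [dist_comm]
  · simpa using hR.le

theorem IsCoarseMap.tendsToZero_comp [MetricSpace X] [MetricSpace Y] {f : X → Y}
    (hf : IsCoarseMap f) {g : Y → ℂ} (hg : TendsToZero g) : TendsToZero (g ∘ f) := by
  intro ε hε
  obtain ⟨B, hB, h1⟩ := hg ε hε
  exact ⟨f ⁻¹' B, hf.proper B hB, fun x hx => h1 _ hx⟩

/-- The homomorphism `B_h(Y) → B_h(X)`, `g ↦ g ∘ f`. -/
def pullbackHom [MetricSpace X] [MetricSpace Y] {f : X → Y} (hf : IsCoarseMap f) :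
    Bh Y →ₐ[ℂ] Bh X where
  toFun g := ⟨(g : Y → ℂ) ∘ f,
    ⟨g.2.1.imp fun _ hC x => hC (f x), hf.slowlyOscillating_comp g.2.2⟩⟩
  map_one' := rfl
  map_mul' _ _ := rfl
  map_zero' := rfl
  map_add' _ _ := rfl
  commutes' _ := rfl

/-- The homomorphism `f^* : B_h(Y) / B_0(Y) → B_h(X) / B_0(X)`, `[g] ↦ [g ∘ f]`. -/
def pullback [MetricSpace X] [MetricSpace Y] {f : X → Y} (hf : IsCoarseMap f) :
    (Bh Y ⧸ B0 Y) →ₐ[ℂ] (Bh X ⧸ B0 X) :=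
  Ideal.quotientMapₐ (B0 X) (pullbackHom hf) (fun _ hg => hf.tendsToZero_comp hg)

/-- The induced map `νf : νX → νY`: the Gelfand dual of `f^*`, where the points of the coronas are
viewed as characters of `C_h / C_0 ≃ B_h / B_0`. -/
def coronaMap [MetricSpace X] [ProperSpace X] [MetricSpace Y] [ProperSpace Y] {f : X → Y}
    (hf : IsCoarseMap f) : C(HigsonCorona X, HigsonCorona Y) where
  toFun φ := (coronaEquiv Y).symm
    ((((coronaEquiv X φ).comp (quotientEquiv X).symm.toAlgHom).comp (pullback hf)).comp
      (quotientEquiv Y).toAlgHom)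
  continuous_toFun := by
    refine Continuous.subtype_mk ?_ _
    refine Continuous.subtype_mk ?_ _
    refine WeakDual.continuous_of_continuous_eval fun g => ?_
    obtain ⟨k, hk⟩ := Ideal.Quotient.mk_surjective ((quotientEquiv X).symm
      (pullback hf (quotientEquiv Y (Ideal.Quotient.mk (C0 Y) g))))
    have : ∀ φ : HigsonCorona X, (coronaEquiv X φ) ((quotientEquiv X).symm
      (pullback hf (quotientEquiv Y (Ideal.Quotient.mk (C0 Y) g)))) = φ.1.1 k := by
      intro φ
      rw [← hk]
      rfl
    refine (((WeakDual.eval_continuous k).comp continuous_subtype_val).comp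
      continuous_subtype_val).congr fun φ => ?_
    exact (this φ).symm

end LargeScale

end

/-! Points of the coronas are characters of `Bh ⧸ B0`, and `coronaMap` becomes precomposition with
`pullback`, so the claims (1) and (2) concern characters only. These are exactly the limits
$g\mapsto\lim_U g$ along ultrafilters $U$ that contain the complements of all bounded sets
(`exists_ultrafilter_isLimitAlong`, `exists_isLimitAlong_of_le_cobounded`), and composing with
`pullback` pushes $U$ forward along $f$.

Two facts then decide everything. Maps at bounded distance that run to infinity give the same limit
character (`IsLimitAlong.eq_of_dist_le`). Sets that diverge from each other are separated by a
slowly oscillating function, up to a bounded set (`Divergent.exists_separating`).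

For a coarse embedding, sets on which some $g$ takes well separated values have divergent images, so
distinct characters stay distinct. If $f$ is not a coarse embedding, two sequences run apart while
their images stay close; divergent subsequences give two characters with the same image. A coarse
section lifts ultrafilters from $Y$ to $X$; conversely, points of $Y$ ever farther from $f(X)$ give
a character outside the image. Claim (3) follows, since a coarse equivalence is a coarsely
surjective coarse embedding and a continuous bijection from a compact space to a Hausdorff space is
a homeomorphism. -/

namespace LargeScale

/-! ### Metric reformulations of the large scale notions -/

section metric

variable {X Y : Type*} [MetricSpace X] [MetricSpace Y] {f : X → Y}

theorem lsContinuous_iff : LSContinuous f ↔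
    ∀ R : ℝ, ∃ S : ℝ, ∀ x x', dist x x' ≤ R → dist (f x) (f x') ≤ S := by
  constructor
  · intro h R
    -- The test family consists of all pairs at distance at most `R`. Its bound is `max R 1` because
    -- a bound must be positive while `R` is arbitrary.
    obtain ⟨S, -, hS⟩ := h (range fun p : {p : X × X // dist p.1 p.2 ≤ R} => {p.1.1, p.1.2})
      ⟨max R 1, by positivity, by
        rintro _ ⟨⟨⟨a, b⟩, hab⟩, rfl⟩ x hx y hy
        simp only [mem_insert_iff, mem_singleton_iff] at hx hy hab
        rcases hx with rfl | rfl <;> rcases hy with rfl | rfl <;> simp [dist_comm] at hab ⊢ <;>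
          simp [hab]⟩
    refine ⟨S, fun x x' hx => hS _ ⟨_, ⟨⟨(x, x'), hx⟩, rfl⟩, rfl⟩ _ ?_ _ ?_⟩ <;> simp
  · rintro h 𝒰 ⟨M, -, hM⟩
    obtain ⟨S, hS⟩ := h M
    refine ⟨max S 1, by positivity, ?_⟩
    rintro _ ⟨U, hU, rfl⟩ _ ⟨x, hx, rfl⟩ _ ⟨y, hy, rfl⟩
    exact (hS x y (hM U hU x hx y hy)).trans (le_max_left _ _)

theorem isCoarseEmbedding_iff (hf : LSContinuous f) : IsCoarseEmbedding f ↔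
    ∀ R : ℝ, ∃ S : ℝ, ∀ x x', dist (f x) (f x') ≤ R → dist x x' ≤ S := by
  constructor
  · rintro ⟨-, h⟩ R
    obtain ⟨S, -, hS⟩ := h (range fun p : {p : Y × Y // dist p.1 p.2 ≤ R} => {p.1.1, p.1.2})
      ⟨max R 1, by positivity, by
        rintro _ ⟨⟨⟨a, b⟩, hab⟩, rfl⟩ x hx y hy
        simp only [mem_insert_iff, mem_singleton_iff] at hx hy hab
        rcases hx with rfl | rfl <;> rcases hy with rfl | rfl <;> simp [dist_comm] at hab ⊢ <;>
          simp [hab]⟩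
    refine ⟨S, fun x x' hx => hS _ ⟨_, ⟨⟨(f x, f x'), hx⟩, rfl⟩, rfl⟩ _ ?_ _ ?_⟩ <;> simp
  · intro h
    refine ⟨hf, ?_⟩
    rintro 𝒰 ⟨M, -, hM⟩
    obtain ⟨S, hS⟩ := h M
    refine ⟨max S 1, by positivity, ?_⟩
    rintro _ ⟨U, hU, rfl⟩ x hx y hy
    exact (hS x y (hM U hU _ hx _ hy)).trans (le_max_left _ _)

theorem close_iff {Z : Type*} {u v : Z → Y} : Close u v ↔ ∃ M : ℝ, ∀ z, dist (u z) (v z) ≤ M := by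
  constructor
  · rintro ⟨M, -, hM⟩
    exact ⟨M, fun z => hM _ ⟨z, rfl⟩ _ (by simp) _ (by simp)⟩
  · rintro ⟨M, hM⟩
    refine ⟨max M 1, by positivity, ?_⟩
    rintro _ ⟨z, rfl⟩ x hx y hy
    have := hM z
    simp only [mem_insert_iff, mem_singleton_iff] at hx hy
    rcases hx with rfl | rfl <;> rcases hy with rfl | rfl <;> simp [dist_comm] at this ⊢ <;>
      simp [this]

theorem coarselySurjective_iff {Z : Type*} {u : Z → Y} : CoarselySurjective u ↔
    ∃ M : ℝ, ∀ y, ∃ z, dist (u z) y ≤ M := by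
  constructor
  · rintro ⟨𝒰, ⟨M, -, hM⟩, h⟩
    refine ⟨M, fun y => ?_⟩
    obtain ⟨U, ⟨hU, _, hzU, z, rfl⟩, hy⟩ := h (mem_univ y)
    exact ⟨z, hM U hU _ hzU _ hy⟩
  · rintro ⟨M, hM⟩
    choose z hz using hM
    refine ⟨range fun y => {u (z y), y}, close_iff (u := u ∘ z) (v := id).2 ⟨M, hz⟩, fun y _ => ?_⟩
    exact ⟨_, ⟨⟨y, rfl⟩, u (z y), by simp, z y, rfl⟩, by simp⟩

theorem LSContinuous.isBounded_image (hf : LSContinuous f) {B : Set X} (hB : IsBounded B) :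
    IsBounded (f '' B) := by
  obtain ⟨C, hC⟩ := Metric.isBounded_iff.1 hB
  obtain ⟨S, hS⟩ := lsContinuous_iff.1 hf C
  refine Metric.isBounded_iff.2 ⟨S, ?_⟩
  rintro _ ⟨x, hx, rfl⟩ _ ⟨y, hy, rfl⟩
  exact hS x y (hC hx hy)

/-- In the converse direction, any choice of approximate preimages is a coarse inverse: the
embedding condition turns closeness in $Y$ into closeness in $X$. -/
theorem isCoarseEquivalence_iff (hf : LSContinuous f) :
    IsCoarseEquivalence f ↔ IsCoarseEmbedding f ∧ CoarselySurjective f := by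
  rw [isCoarseEmbedding_iff hf, coarselySurjective_iff]
  constructor
  · rintro ⟨-, f', hf', h1, h2⟩
    obtain ⟨M, hM⟩ := close_iff.1 h1
    obtain ⟨N, hN⟩ := close_iff.1 h2
    refine ⟨fun R => ?_, M, fun y => ⟨f' y, hM y⟩⟩
    obtain ⟨S, hS⟩ := lsContinuous_iff.1 hf' R
    refine ⟨N + S + N, fun x x' hx => ?_⟩
    have e1 := hN x
    have e2 := hN x'
    have e3 := hS _ _ hx
    simp only [Function.comp_apply, id_eq] at e1 e2
    rw [dist_comm] at e1
    linarith [dist_triangle4 x (f' (f x)) (f' (f x')) x']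
  · rintro ⟨h, M, hM⟩
    choose s hs using hM
    refine ⟨hf, s, lsContinuous_iff.2 fun R => ?_, close_iff.2 ⟨M, hs⟩, ?_⟩
    · obtain ⟨S, hS⟩ := h (M + R + M)
      refine ⟨S, fun y y' hy => hS _ _ ?_⟩
      have e1 := hs y
      have e2 := hs y'
      rw [dist_comm] at e2
      linarith [dist_triangle4 (f (s y)) y y' (f (s y'))]
    · obtain ⟨S, hS⟩ := h M
      exact close_iff.2 ⟨S, fun x => hS _ _ (hs (f x))⟩

end metric

/-! ### Characters of `B_h / B_0` as limits along ultrafilters -/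

section ultrafilters

variable {X : Type*} [MetricSpace X]

/-- The character `χ` of `B_h(X) / B_0(X)` is the limit along the ultrafilter `U`. -/
def IsLimitAlong (χ : (Bh X ⧸ B0 X) →ₐ[ℂ] ℂ) (U : Ultrafilter X) : Prop :=
  ∀ g : Bh X, Tendsto (g : X → ℂ) U (𝓝 (χ (Ideal.Quotient.mk (B0 X) g)))

theorem tendsto_zero_of_tendsToZero {g : X → ℂ} (hg : TendsToZero g) :
    Tendsto g (cobounded X) (𝓝 0) := by
  rw [Metric.tendsto_nhds]
  intro ε hε
  obtain ⟨B, hB, h⟩ := hg (ε / 2) (by positivity)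
  filter_upwards [hB.compl] with x hx
  have := h x hx
  rw [dist_zero_right]
  linarith

/-- A bounded function takes values in a compact disc, so it converges along every ultrafilter, and
limits respect the algebra operations. The condition on `U` makes the functions in `B0` converge to
zero. -/
theorem exists_isLimitAlong_of_le_cobounded (U : Ultrafilter X) (hU : (U : Filter X) ≤ cobounded X) :
    ∃ χ, IsLimitAlong χ U := by
  have key : ∀ g : Bh X, ∃ z, Tendsto (g : X → ℂ) U (𝓝 z) := by
    rintro ⟨g, ⟨C, hC⟩, hg⟩
    obtain ⟨z, -, hz⟩ := (isCompact_closedBall (0 : ℂ) C).ultrafilter_le_nhds (U.map g)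
      (le_principal_iff.2 (by
        refine Ultrafilter.mem_map.2 (mem_of_superset univ_mem fun x _ => ?_)
        simpa using hC x))
    exact ⟨z, hz⟩
  choose L hL using key
  have uniq : ∀ (g : Bh X) z, Tendsto (g : X → ℂ) U (𝓝 z) → L g = z := fun g z h =>
    tendsto_nhds_unique (hL g) h
  let Φ : Bh X →ₐ[ℂ] ℂ :=
    { toFun := L
      map_one' := uniq _ _ tendsto_const_nhds
      map_mul' := fun g h => uniq _ _ ((hL g).mul (hL h))
      map_zero' := uniq _ _ tendsto_const_nhds
      map_add' := fun g h => uniq _ _ ((hL g).add (hL h))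
      commutes' := fun c => uniq _ _ tendsto_const_nhds }
  exact ⟨Ideal.Quotient.liftₐ (B0 X) Φ fun g hg =>
    uniq _ _ ((tendsto_zero_of_tendsToZero hg).mono_left hU), hL⟩

theorem isUnit_Bh_of_le (g : Bh X) {c : ℝ} (hc : 0 < c) (h : ∀ x, c ≤ ‖(g : X → ℂ) x‖) :
    IsUnit g := by
  refine IsUnit.of_mul_eq_one (⟨fun x => ((g : X → ℂ) x)⁻¹, ⟨c⁻¹, fun x => ?_⟩,
    SlowlyOscillating.inv g.2.2 hc h⟩ : Bh X) ?_
  · rw [norm_inv]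
    exact inv_anti₀ hc (h x)
  · apply Subtype.ext
    ext x
    exact mul_inv_cancel₀ (norm_pos_iff.1 (hc.trans_le (h x)))

/-- The sets $\{|a|<\varepsilon\}$ with $a$ in the kernel of the character generate a proper filter:
if one were empty, $a$ would be bounded away from zero, hence a unit. Any finer ultrafilter works,
since $g-\chi(g)$ lies in the kernel for every $g$. -/
theorem exists_ultrafilter_isLimitAlong (χ : (Bh X ⧸ B0 X) →ₐ[ℂ] ℂ) :
    ∃ U : Ultrafilter X, (U : Filter X) ≤ cobounded X ∧ IsLimitAlong χ U := by
  let Φ : Bh X →ₐ[ℂ] ℂ := χ.comp (Ideal.Quotient.mkₐ ℂ (B0 X))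
  let N : {p : Bh X × ℝ // Φ p.1 = 0 ∧ 0 < p.2} → Set X := fun p => {x | ‖(p.1.1 : X → ℂ) x‖ < p.1.2}
  have hne : ∀ p, (N p).Nonempty := by
    rintro ⟨⟨a, ε⟩, ha, hε⟩
    by_contra hemp
    have hu : IsUnit a := isUnit_Bh_of_le a hε fun x => by
      by_contra! hx
      exact hemp ⟨x, hx⟩
    have := hu.map Φ
    simp only at ha
    rw [ha] at this
    exact not_isUnit_zero this
  have hdir : Directed (· ≥ ·) fun p => 𝓟 (N p) := by
    rintro ⟨⟨a, ε⟩, ha, hε⟩ ⟨⟨b, δ⟩, hb, hδ⟩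
    simp only at ha hb hε hδ
    have hval : ∀ x, ‖((Star.star a * a + Star.star b * b : Bh X) : X → ℂ) x‖ =
        ‖(a : X → ℂ) x‖ ^ 2 + ‖(b : X → ℂ) x‖ ^ 2 := by
      intro x
      have e1 := Complex.conj_mul' ((a : X → ℂ) x)
      have e2 := Complex.conj_mul' ((b : X → ℂ) x)
      have e : ((Star.star a * a + Star.star b * b : Bh X) : X → ℂ) x =
          ((‖(a : X → ℂ) x‖ ^ 2 + ‖(b : X → ℂ) x‖ ^ 2 : ℝ) : ℂ) := by
        push_cast
        rw [← e1, ← e2]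
        rfl
      rw [e, Complex.norm_real, Real.norm_of_nonneg (by positivity)]
    -- The element $|a|^2+|b|^2$ is again in the kernel, and where it is below
    -- $\min(\varepsilon,\delta)^2$ both $|a|<\varepsilon$ and $|b|<\delta$ hold.
    refine ⟨⟨(Star.star a * a + Star.star b * b, min ε δ ^ 2), by simp [ha, hb], by positivity⟩,
      principal_mono.2 fun x hx => ?_, principal_mono.2 fun x hx => ?_⟩
    all_goals
      have hx' := hx
      simp only [N, mem_ofPred_eq] at hx' ⊢
      rw [hval] at hx'
    · refine (lt_of_pow_lt_pow_left₀ 2 (by positivity) ?_).trans_le (min_le_left ε δ)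
      linarith [sq_nonneg ‖(b : X → ℂ) x‖]
    · refine (lt_of_pow_lt_pow_left₀ 2 (by positivity) ?_).trans_le (min_le_right ε δ)
      linarith [sq_nonneg ‖(a : X → ℂ) x‖]
  have : Nonempty {p : Bh X × ℝ // Φ p.1 = 0 ∧ 0 < p.2} := ⟨⟨(0, 1), by simp, by simp⟩⟩
  have : NeBot (⨅ p, 𝓟 (N p)) :=
    iInf_neBot_of_directed' hdir fun p => principal_neBot_iff.2 (hne p)
  have hmem : ∀ p, N p ∈ Ultrafilter.of (⨅ p, 𝓟 (N p)) := fun p =>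
    Ultrafilter.of_le _ (mem_iInf_of_mem p (mem_principal_self _))
  refine ⟨Ultrafilter.of (⨅ p, 𝓟 (N p)), fun s hs => ?_, fun g => ?_⟩
  -- The indicator of the bounded set `sᶜ` need not be continuous but belongs to `B0`, hence to the
  -- kernel; it is less than 1 only on `s`.
  · have hz : TendsToZero (sᶜ.indicator fun _ => (1 : ℂ)) := fun ε hε =>
      ⟨sᶜ, isBounded_def.2 (by simpa using hs), fun x hx => by simp [indicator_of_notMem hx, hε.le]⟩
    let i : Bh X := ⟨sᶜ.indicator fun _ => (1 : ℂ), ⟨1, fun x => by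
      by_cases hx : x ∈ sᶜ <;> simp [indicator, hx]⟩, hz.slowlyOscillating⟩
    have hi : Φ i = 0 := by
      change χ (Ideal.Quotient.mk (B0 X) i) = 0
      rw [Ideal.Quotient.eq_zero_iff_mem.2 (show i ∈ B0 X from hz), map_zero]
    refine mem_of_superset (hmem ⟨(i, 1), hi, one_pos⟩) fun x hx => ?_
    by_contra hxs
    have : ‖sᶜ.indicator (fun _ => (1 : ℂ)) x‖ < 1 := hx
    simp [indicator, hxs] at this
  · rw [Metric.tendsto_nhds]
    intro ε hε
    refine mem_of_superset
      (hmem ⟨(g - algebraMap ℂ (Bh X) (Φ g), ε), by simp, hε⟩) fun x hx => ?_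
    rw [mem_ofPred_eq, dist_eq_norm]
    exact hx

end ultrafilters

/-! ### Separation of divergent sets -/

/-- Points of `B` at bounded distance from `A` stay in a bounded set. -/
def Divergent {X : Type*} [MetricSpace X] (A B : Set X) : Prop :=
  ∀ R : ℝ, IsBounded {b ∈ B | ∃ a ∈ A, dist a b ≤ R}

/-- With $u,v$ the distances to $A$ and $B$, the function is $u/\max(1,u+v)$. Divergence means that
$u+v$ tends to infinity; as $u$ and $v$ are 1-Lipschitz, the quotient oscillates less and less. -/
theorem Divergent.exists_separating {X : Type*} [MetricSpace X] {A B : Set X}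
    (h : Divergent A B) : ∃ g : Bh X, (∀ a ∈ A, (g : X → ℂ) a = 0) ∧
      ∃ C, IsBounded C ∧ ∀ b ∈ B, b ∉ C → (g : X → ℂ) b = 1 := by
  -- `Metric.infDist` to the empty set is 0, so the formula fails when either set is empty.
  rcases A.eq_empty_or_nonempty with rfl | hA
  · exact ⟨1, by simp, ∅, isBounded_empty, fun _ _ _ => rfl⟩
  rcases B.eq_empty_or_nonempty with rfl | hB
  · exact ⟨0, fun _ _ => rfl, ∅, isBounded_empty, by simp⟩
  let u : X → ℝ := fun x => Metric.infDist x A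
  let v : X → ℝ := fun x => Metric.infDist x B
  let m : X → ℝ := fun x => max 1 (u x + v x)
  have hu0 : ∀ x, 0 ≤ u x := fun x => Metric.infDist_nonneg
  have hv0 : ∀ x, 0 ≤ v x := fun x => Metric.infDist_nonneg
  have hm1 : ∀ x, 1 ≤ m x := fun x => le_max_left _ _
  have hum : ∀ x, u x ≤ m x := fun x => (le_add_of_nonneg_right (hv0 x)).trans (le_max_right _ _)
  have hlarge : ∀ K : ℝ, IsBounded {x | u x + v x < K} := by
    intro K
    -- A point within `K` of some $a\in A$ and of some $b\in B$ forces $d(a,b)\le 2K$, so $b$ lies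
    -- in a bounded set and the point lies near it.
    have hb : IsBounded (Metric.cthickening K {b ∈ B | ∃ a ∈ A, dist a b ≤ K + K}) :=
      (h (K + K)).cthickening
    refine hb.subset fun x hx => ?_
    simp only [mem_ofPred_eq] at hx
    obtain ⟨a, ha, hxa⟩ := (Metric.infDist_lt_iff hA).1 (by linarith [hv0 x] : u x < K)
    obtain ⟨b, hb, hxb⟩ := (Metric.infDist_lt_iff hB).1 (by linarith [hu0 x] : v x < K)
    refine Metric.mem_cthickening_of_dist_le x b K _ ⟨hb, a, ha, ?_⟩ hxb.le
    linarith [dist_triangle_left a b x]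
  have hub : ∀ x, ‖((u x / m x : ℝ) : ℂ)‖ ≤ 1 := fun x => by
    rw [Complex.norm_real, Real.norm_of_nonneg (div_nonneg (hu0 x) (by linarith [hm1 x]))]
    exact div_le_one_of_le₀ (hum x) (by linarith [hm1 x])
  have hso : SlowlyOscillating fun x => ((u x / m x : ℝ) : ℂ) := by
    intro R hR ε hε
    -- Moving by at most `R` changes $u$ by at most `R` and $m$ by at most `2 * R`, so the quotient
    -- changes by at most $3R/m$.
    refine ⟨_, hlarge (3 * R / ε), fun x hx x' hx' hd => ?_⟩
    have hK : 3 * R / ε ≤ m x := (not_lt.1 hx).trans (le_max_right _ _)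
    have e1 : |u x - u x'| ≤ R :=
      ((Metric.lipschitz_infDist_pt A).dist_le_mul x x').trans (by simpa using hd)
    have e2 : |v x - v x'| ≤ R :=
      ((Metric.lipschitz_infDist_pt B).dist_le_mul x x').trans (by simpa using hd)
    have e3 : |m x' - m x| ≤ 2 * R := by
      refine (abs_max_sub_max_le_max _ _ _ _).trans (max_le (by simpa using hR.le) ?_)
      rw [abs_le] at e1 e2 ⊢
      constructor <;> linarith [e1.1, e1.2, e2.1, e2.2]
    have p := hm1 x
    have p' := hm1 x'
    rw [← Complex.ofReal_sub, Complex.norm_real, Real.norm_eq_abs]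
    have e4 : u x / m x - u x' / m x' = ((u x - u x') + (u x' / m x') * (m x' - m x)) / m x := by
      field_simp
      ring
    have e5 : |u x' / m x'| ≤ 1 := by
      rw [abs_of_nonneg (div_nonneg (hu0 x') (by linarith))]
      exact div_le_one_of_le₀ (hum x') (by linarith)
    rw [e4, abs_div, abs_of_pos (by linarith : 0 < m x), div_le_iff₀ (by linarith)]
    calc |u x - u x' + u x' / m x' * (m x' - m x)|
        ≤ |u x - u x'| + |u x' / m x'| * |m x' - m x| := by
          rw [← abs_mul]
          exact abs_add_le _ _
      _ ≤ R + 1 * (2 * R) := by gcongr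
      _ = 3 * R / ε * ε := by field_simp; ring
      _ ≤ m x * ε := by gcongr
      _ = ε * m x := mul_comm _ _
  refine ⟨⟨_, ⟨1, hub⟩, hso⟩, fun a ha => ?_, _, hlarge 1, fun b hb hbC => ?_⟩
  · simp [u, Metric.infDist_zero_of_mem ha]
  · have hv : v b = 0 := Metric.infDist_zero_of_mem hb
    have hb' : 1 ≤ u b := by simpa [hv] using hbC
    have : m b = u b := by simp [m, hv, hb']
    simp only [this]
    rw [div_self (by linarith)]
    simp

/-! ### The coarse map and the characters of `B_h / B_0` -/

theorem SlowlyOscillating.tendsto_sub {X ι : Type*} [MetricSpace X] {g : X → ℂ}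
    (hg : SlowlyOscillating g) {l : Filter ι} {u v : ι → X} (hu : Tendsto u l (cobounded X))
    (hv : Tendsto v l (cobounded X)) {R : ℝ} (hR : ∀ i, dist (u i) (v i) ≤ R) :
    Tendsto (fun i => g (u i) - g (v i)) l (𝓝 0) := by
  rw [Metric.tendsto_nhds]
  intro ε hε
  obtain ⟨B, hB, h⟩ := hg (max R 1) (by positivity) (ε / 2) (by positivity)
  filter_upwards [hu hB.compl, hv hB.compl] with i h1 h2
  have := h _ h1 _ h2 ((hR i).trans (le_max_left _ _))
  rw [dist_zero_right]
  linarith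

section characters

variable {X Y : Type*} [MetricSpace X] [MetricSpace Y] {f : X → Y}

theorem IsCoarseMap.tendsto_cobounded (hf : IsCoarseMap f) :
    Tendsto f (cobounded X) (cobounded Y) := fun s hs => by
  have := hf.proper sᶜ (isBounded_def.2 (by simpa using hs))
  rwa [preimage_compl, isBounded_compl_iff] at this

theorem IsLimitAlong.comp_pullback {χ : (Bh X ⧸ B0 X) →ₐ[ℂ] ℂ} {U : Ultrafilter X}
    (h : IsLimitAlong χ U) (hf : IsCoarseMap f) :
    IsLimitAlong (χ.comp (pullback hf)) (U.map f) :=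
  fun g => h (pullbackHom hf g)

/-- A slowly oscillating function cannot tell apart, in the limit, two maps that go to infinity at
bounded distance from each other. -/
theorem IsLimitAlong.eq_of_dist_le {ι : Type*} {χ χ' : (Bh X ⧸ B0 X) →ₐ[ℂ] ℂ} {U : Ultrafilter ι}
    {u v : ι → X} (h : IsLimitAlong χ (U.map u)) (h' : IsLimitAlong χ' (U.map v))
    (hu : Tendsto u U (cobounded X)) (hv : Tendsto v U (cobounded X)) {R : ℝ}
    (hR : ∀ i, dist (u i) (v i) ≤ R) : χ = χ' := by
  ext a
  obtain ⟨g, rfl⟩ := Ideal.Quotient.mk_surjective a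
  have h1 : Tendsto (fun i => (g : X → ℂ) (u i)) U _ := h g
  have h2 : Tendsto (fun i => (g : X → ℂ) (v i)) U _ := h' g
  exact sub_eq_zero.1 (tendsto_nhds_unique (h1.sub h2) (g.2.2.tendsto_sub hu hv hR))

theorem IsLimitAlong.eq_of_eventually {χ : (Bh X ⧸ B0 X) →ₐ[ℂ] ℂ} {U : Ultrafilter X}
    (h : IsLimitAlong χ U) {g : Bh X} {z : ℂ} (hz : ∀ᶠ x in (U : Filter X), (g : X → ℂ) x = z) :
    χ (Ideal.Quotient.mk (B0 X) g) = z :=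
  tendsto_nhds_unique (h g) (tendsto_const_nhds.congr' (hz.mono fun _ e => e.symm))

/-! ### Injectivity and coarse embeddings -/

theorem comp_pullback_injective (hf : IsCoarseMap f) (he : IsCoarseEmbedding f) :
    Function.Injective fun χ : (Bh X ⧸ B0 X) →ₐ[ℂ] ℂ => χ.comp (pullback hf) := by
  intro χ χ' hχ
  by_contra hne
  obtain ⟨a, ha⟩ : ∃ a, χ a ≠ χ' a := by
    by_contra! hall
    exact hne (AlgHom.ext hall)
  obtain ⟨g, rfl⟩ := Ideal.Quotient.mk_surjective a
  obtain ⟨U, hUc, hU⟩ := exists_ultrafilter_isLimitAlong χ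
  obtain ⟨V, hVc, hV⟩ := exists_ultrafilter_isLimitAlong χ'
  set z := χ (Ideal.Quotient.mk (B0 X) g)
  set z' := χ' (Ideal.Quotient.mk (B0 X) g)
  -- A quarter suffices: a path from $z$ to $z'$ through nearby values of `g` has three pieces, each
  -- at most a quarter of the distance.
  have hδ : 0 < dist z z' / 4 := by have := dist_pos.2 ha; positivity
  let A : Set X := {x | dist ((g : X → ℂ) x) z < dist z z' / 4}
  let B : Set X := {x | dist ((g : X → ℂ) x) z' < dist z z' / 4}
  have hA : A ∈ U := Metric.tendsto_nhds.1 (hU g) _ hδ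
  have hB : B ∈ V := Metric.tendsto_nhds.1 (hV g) _ hδ
  -- If $f(a)$ and $f(b)$ are close then so are $a$ and $b$. Yet $g(a)$ and $g(b)$ are far apart, so
  -- $a$ or $b$ lies in the bounded set where `g` may still oscillate.
  have hdiv : Divergent (f '' A) (f '' B) := by
    intro R
    obtain ⟨S, hS⟩ := (isCoarseEmbedding_iff hf.lsContinuous).1 he R
    obtain ⟨C, hC, h⟩ := g.2.2 (max S 1) (by positivity) (dist z z' / 4) hδ
    refine (hf.lsContinuous.isBounded_image (hC.cthickening (δ := max S 1))).subset ?_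
    rintro _ ⟨⟨b, hb, rfl⟩, _, ⟨a, ha, rfl⟩, hab⟩
    have hd := (hS a b hab).trans (le_max_left S 1)
    refine ⟨b, ?_, rfl⟩
    by_cases hbC : b ∈ C
    · exact Metric.self_subset_cthickening C hbC
    by_cases haC : a ∈ C
    · exact Metric.mem_cthickening_of_dist_le b a _ C haC (by rwa [dist_comm])
    have e := h a haC b hbC hd
    rw [← dist_eq_norm] at e
    have e1 : dist ((g : X → ℂ) a) z < dist z z' / 4 := ha
    have e2 : dist ((g : X → ℂ) b) z' < dist z z' / 4 := hb
    rw [dist_comm] at e1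
    linarith [dist_triangle4 z ((g : X → ℂ) a) ((g : X → ℂ) b) z']
  obtain ⟨k, hk0, C, hC, hk1⟩ := hdiv.exists_separating
  have h0 : (χ.comp (pullback hf)) (Ideal.Quotient.mk (B0 Y) k) = 0 :=
    (hU.comp_pullback hf).eq_of_eventually
      (Ultrafilter.mem_map.2 (mem_of_superset hA fun x hx => hk0 _ ⟨x, hx, rfl⟩))
  have h1 : (χ'.comp (pullback hf)) (Ideal.Quotient.mk (B0 Y) k) = 1 := by
    refine (hV.comp_pullback hf).eq_of_eventually (Ultrafilter.mem_map.2 ?_)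
    filter_upwards [hB, hVc (hf.proper C hC).compl] with x hx hxC
    exact hk1 _ ⟨x, hx, rfl⟩ hxC
  have e := DFunLike.congr_fun hχ (Ideal.Quotient.mk (B0 Y) k)
  simp only [h0, h1] at e
  exact zero_ne_one e

/-- If $x_n$ lies in a bounded set, then $f(y_n)$ is near a bounded set, and properness confines
$y_n$ too. This bounds $d(x_n,y_n)$, hence $n$. -/
theorem IsCoarseMap.tendsto_cobounded_of_dist (hf : IsCoarseMap f) {x y : ℕ → X} {R : ℝ}
    (hR : ∀ n, dist (f (x n)) (f (y n)) ≤ R) (hxy : ∀ n : ℕ, (n : ℝ) < dist (x n) (y n)) :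
    Tendsto x atTop (cobounded X) := by
  intro s hs
  have hb : IsBounded sᶜ := isBounded_def.2 (by simpa using hs)
  have hb' := hf.proper _ ((hf.lsContinuous.isBounded_image hb).cthickening (δ := R))
  obtain ⟨C, hC⟩ := Metric.isBounded_iff.1 (hb.union hb')
  rw [mem_map]
  filter_upwards [eventually_ge_atTop ⌈C⌉₊] with n hn
  by_contra hx
  have hy : y n ∈ f ⁻¹' Metric.cthickening R (f '' sᶜ) :=
    Metric.mem_cthickening_of_dist_le _ (f (x n)) _ _ ⟨x n, hx, rfl⟩ (by rw [dist_comm]; exact hR n)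
  linarith [hC (Or.inl hx) (Or.inr hy), hxy n, Nat.ceil_le.1 hn]

/-- The subsequence is sparse: each new term is at least twice as far from the base point as all
earlier terms of the other sequence. Closeness of two terms with different indices then bounds their
distance to the base point; for equal indices, `hxy` bounds the index. -/
theorem exists_subseq_divergent {x y : ℕ → X} (hx : Tendsto x atTop (cobounded X))
    (hy : Tendsto y atTop (cobounded X)) (hxy : ∀ n : ℕ, (n : ℝ) < dist (x n) (y n)) :
    ∃ σ : ℕ → ℕ, StrictMono σ ∧ Divergent (range (x ∘ σ)) (range (y ∘ σ)) := by
  let o := x 0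
  have hev : ∀ (z : ℕ → X), Tendsto z atTop (cobounded X) → ∀ K : ℝ, ∀ᶠ n in atTop, K ≤ dist (z n) o :=
    fun z hz K => ((Metric.tendsto_dist_right_cobounded_atTop o).comp hz).eventually_ge_atTop K
  obtain ⟨σ, -, hσ⟩ := exists_seq_of_forall_finset_exists (fun _ : ℕ => True)
    (fun m n => m < n ∧ 2 * dist (y m) o ≤ dist (x n) o ∧ 2 * dist (x m) o ≤ dist (y n) o)
    (fun s _ => by
      obtain ⟨n, hn⟩ := (((eventually_all_finset s).2 fun m _ =>
        (eventually_gt_atTop m).and ((hev x hx (2 * dist (y m) o)).and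
          (hev y hy (2 * dist (x m) o))))).exists
      exact ⟨n, trivial, hn⟩)
  have hmono : StrictMono σ := fun m n h => (hσ m n h).1
  refine ⟨σ, hmono, fun R => ?_⟩
  refine ((((finite_le_nat ⌈R⌉₊).image (y ∘ σ)).isBounded).union
    (Metric.isBounded_closedBall (x := o) (r := 2 * R))).subset ?_
  rintro _ ⟨⟨n, rfl⟩, _, ⟨m, rfl⟩, h⟩
  simp only [Function.comp_apply] at h
  have t1 := dist_triangle_left (x (σ m)) o (y (σ n))
  have t2 := dist_triangle_left (y (σ n)) o (x (σ m))
  rw [dist_comm (y (σ n)) (x (σ m))] at t1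
  have p := dist_nonneg (x := x (σ m)) (y := y (σ n))
  rcases lt_trichotomy m n with hmn | rfl | hmn
  · right
    have := (hσ m n hmn).2.2
    simp only [Function.comp_apply, Metric.mem_closedBall]
    linarith
  · left
    refine ⟨m, ?_, rfl⟩
    have h1 : (m : ℝ) ≤ σ m := by exact_mod_cast hmono.le_apply
    have h2 := hxy (σ m)
    have h3 : (m : ℝ) ≤ ⌈R⌉₊ := by linarith [Nat.le_ceil R]
    exact_mod_cast h3
  · right
    have := (hσ n m hmn).2.1
    simp only [Function.comp_apply, Metric.mem_closedBall]
    linarith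

theorem isCoarseEmbedding_of_injective (hf : IsCoarseMap f)
    (hinj : Function.Injective fun χ : (Bh X ⧸ B0 X) →ₐ[ℂ] ℂ => χ.comp (pullback hf)) :
    IsCoarseEmbedding f := by
  rw [isCoarseEmbedding_iff hf.lsContinuous]
  by_contra! hcon
  obtain ⟨R, hR⟩ := hcon
  choose x y hfxy hxy using fun n : ℕ => hR n
  have hx := hf.tendsto_cobounded_of_dist hfxy hxy
  have hy := hf.tendsto_cobounded_of_dist (x := y) (y := x)
    (fun n => by rw [dist_comm]; exact hfxy n) (fun n => by rw [dist_comm]; exact hxy n)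
  obtain ⟨σ, hσ, hdiv⟩ := exists_subseq_divergent hx hy hxy
  let 𝒰 : Ultrafilter ℕ := hyperfilter ℕ
  have hσ' : Tendsto σ 𝒰 atTop := hσ.tendsto_atTop.mono_left Nat.hyperfilter_le_atTop
  have hx' : Tendsto (x ∘ σ) 𝒰 (cobounded X) := hx.comp hσ'
  have hy' : Tendsto (y ∘ σ) 𝒰 (cobounded X) := hy.comp hσ'
  obtain ⟨χ, hχ⟩ := exists_isLimitAlong_of_le_cobounded (𝒰.map (x ∘ σ)) hx'
  obtain ⟨χ', hχ'⟩ := exists_isLimitAlong_of_le_cobounded (𝒰.map (y ∘ σ)) hy'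
  -- Both limits use the same ultrafilter on the indices, so the bound on $d(f(x_n),f(y_n))$
  -- identifies the two image characters.
  have heq : χ = χ' := hinj (IsLimitAlong.eq_of_dist_le (U := 𝒰) (u := f ∘ x ∘ σ) (v := f ∘ y ∘ σ)
    (hχ.comp_pullback hf) (hχ'.comp_pullback hf) (hf.tendsto_cobounded.comp hx')
    (hf.tendsto_cobounded.comp hy') fun n => hfxy (σ n))
  obtain ⟨k, hk0, C, hC, hk1⟩ := hdiv.exists_separating
  have h0 := hχ.eq_of_eventually (g := k) (z := 0)
    (Ultrafilter.mem_map.2 (mem_of_superset univ_mem fun n _ => hk0 _ ⟨n, rfl⟩))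
  have h1 := hχ'.eq_of_eventually (g := k) (z := 1)
    (Ultrafilter.mem_map.2 (mem_of_superset (hy' hC.compl) fun n hn => hk1 _ ⟨n, rfl⟩ hn))
  rw [heq, h1] at h0
  exact one_ne_zero h0

/-! ### Surjectivity and coarse surjectivity -/

theorem comp_pullback_surjective (hf : IsCoarseMap f) (hs : CoarselySurjective f) :
    Function.Surjective fun χ : (Bh X ⧸ B0 X) →ₐ[ℂ] ℂ => χ.comp (pullback hf) := by
  intro ψ
  obtain ⟨M, hM⟩ := coarselySurjective_iff.1 hs
  choose s hs using hM
  obtain ⟨V, hVc, hV⟩ := exists_ultrafilter_isLimitAlong ψ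
  -- If $s(y)$ stays in a bounded set, then $y$ is within $M$ of the bounded image of that set.
  have hsc : Tendsto s (cobounded Y) (cobounded X) := by
    intro t ht
    have hb : IsBounded tᶜ := isBounded_def.2 (by simpa using ht)
    have hb' := (hf.lsContinuous.isBounded_image hb).cthickening (δ := M)
    rw [mem_map]
    filter_upwards [hb'.compl] with y hy
    by_contra hyt
    exact hy (Metric.mem_cthickening_of_dist_le _ (f (s y)) _ _ ⟨s y, hyt, rfl⟩
      (by rw [dist_comm]; exact hs y))
  have hsV : Tendsto s V (cobounded X) := hsc.mono_left hVc
  obtain ⟨χ, hχ⟩ := exists_isLimitAlong_of_le_cobounded (V.map s) hsV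
  exact ⟨χ, IsLimitAlong.eq_of_dist_le (U := V) (u := f ∘ s) (v := id) (hχ.comp_pullback hf)
    hV (hf.tendsto_cobounded.comp hsV) hVc hs⟩

theorem coarselySurjective_of_surjective (hf : IsCoarseMap f) (hne : Nonempty Y → Nonempty X)
    (hsurj : Function.Surjective fun χ : (Bh X ⧸ B0 X) →ₐ[ℂ] ℂ => χ.comp (pullback hf)) :
    CoarselySurjective f := by
  rw [coarselySurjective_iff]
  by_contra! hcon
  choose y hy using fun n : ℕ => hcon n
  -- A point of $f(X)$ is needed to force $y_n$ to infinity. For empty $X$ and non-empty bounded $Y$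
  -- both coronas are empty, so $\nu f$ is surjective while $f$ is not coarsely surjective.
  obtain ⟨x₀⟩ := hne ⟨y 0⟩
  have hyc : Tendsto y atTop (cobounded Y) := by
    rw [← Metric.comap_dist_right_atTop (f x₀), tendsto_comap_iff]
    refine tendsto_atTop_mono (fun n => ?_) tendsto_natCast_atTop_atTop
    rw [Function.comp_apply, dist_comm]
    exact (hy n x₀).le
  have hdiv : Divergent (range f) (range y) := by
    intro R
    refine (((finite_le_nat ⌈R⌉₊).image y).isBounded).subset ?_
    rintro _ ⟨⟨n, rfl⟩, _, ⟨x, rfl⟩, h⟩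
    refine ⟨n, ?_, rfl⟩
    have h3 : (n : ℝ) ≤ ⌈R⌉₊ := by linarith [Nat.le_ceil R, hy n x]
    exact_mod_cast h3
  obtain ⟨k, hk0, C, hC, hk1⟩ := hdiv.exists_separating
  let 𝒰 : Ultrafilter ℕ := hyperfilter ℕ
  have hy' : Tendsto y 𝒰 (cobounded Y) := hyc.mono_left Nat.hyperfilter_le_atTop
  obtain ⟨ψ, hψ⟩ := exists_isLimitAlong_of_le_cobounded (𝒰.map y) hy'
  obtain ⟨χ, rfl⟩ := hsurj ψ
  have h1 := hψ.eq_of_eventually (g := k) (z := 1)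
    (Ultrafilter.mem_map.2 (mem_of_superset (hy' hC.compl) fun n hn => hk1 _ ⟨n, rfl⟩ hn))
  obtain ⟨U, -, hU⟩ := exists_ultrafilter_isLimitAlong χ
  -- The separating function vanishes on $f(X)$, so every character in the image kills it, whereas
  -- the limit along $y$ takes the value 1.
  have h0 := (hU.comp_pullback hf).eq_of_eventually (g := k) (z := 0)
    (Ultrafilter.mem_map.2 (mem_of_superset univ_mem fun x _ => hk0 _ ⟨x, rfl⟩))
  exact one_ne_zero (h1.symm.trans h0)

end characters

/-! ### The corona as the space of characters of `B_h / B_0` -/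

/-- The points of `νX` are exactly the characters of `B_h(X) / B_0(X)`. -/
noncomputable def coronaEquivBh (X : Type*) [MetricSpace X] [ProperSpace X] :
    HigsonCorona X ≃ ((Bh X ⧸ B0 X) →ₐ[ℂ] ℂ) :=
  (coronaEquiv X).trans ((quotientEquiv X).arrowCongr AlgEquiv.refl)

theorem coronaEquivBh_coronaMap {X Y : Type*} [MetricSpace X] [ProperSpace X] [MetricSpace Y]
    [ProperSpace Y] {f : X → Y} (hf : IsCoarseMap f) (φ : HigsonCorona X) :
    coronaEquivBh Y (coronaMap hf φ) = (coronaEquivBh X φ).comp (pullback hf) := by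
  have e : coronaMap hf φ = (coronaEquiv Y).symm
    ((((coronaEquiv X φ).comp (quotientEquiv X).symm.toAlgHom).comp (pullback hf)).comp
      (quotientEquiv Y).toAlgHom) := rfl
  rw [e, coronaEquivBh, Equiv.trans_apply, Equiv.apply_symm_apply]
  ext a
  simp [coronaEquivBh, AlgEquiv.arrowCongr]

/-- The corona is the common zero set of `C0 X` in the compact spectrum, hence closed. -/
theorem isCompact_HigsonCorona (X : Type*) [MetricSpace X] [ProperSpace X] :
    IsCompact (HigsonCorona X) := by
  have e : HigsonCorona X = ⋂ g ∈ C0 X, {φ : HigsonCompactification X | φ g = 0} := by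
    ext φ
    simp only [mem_iInter]
    exact ⟨fun hφ g hg => corona_vanish φ hφ g hg, fun h => mem_corona_of_vanish φ h⟩
  rw [e]
  refine (isClosed_biInter fun g _ => ?_).isCompact
  exact isClosed_eq ((WeakDual.eval_continuous g).comp continuous_subtype_val) continuous_const

/-! ### Transfer from characters to the Higson coronas -/

section coronaMap

variable {X Y : Type*} [MetricSpace X] [ProperSpace X] [MetricSpace Y] [ProperSpace Y] {f : X → Y}

theorem coronaMap_eq (hf : IsCoarseMap f) : ⇑(coronaMap hf) =
    (coronaEquivBh Y).symm ∘ (fun χ => χ.comp (pullback hf)) ∘ coronaEquivBh X := by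
  ext1 φ
  simp [← coronaEquivBh_coronaMap]

theorem coronaMap_injective_iff (hf : IsCoarseMap f) :
    Function.Injective (coronaMap hf) ↔ IsCoarseEmbedding f := by
  rw [coronaMap_eq, Equiv.comp_injective, Equiv.injective_comp]
  exact ⟨isCoarseEmbedding_of_injective hf, comp_pullback_injective hf⟩

theorem coronaMap_surjective_iff (hf : IsCoarseMap f) (hne : Nonempty Y → Nonempty X) :
    Function.Surjective (coronaMap hf) ↔ CoarselySurjective f := by
  rw [coronaMap_eq, Equiv.comp_surjective, Equiv.surjective_comp]
  exact ⟨coarselySurjective_of_surjective hf hne, comp_pullback_surjective hf⟩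

theorem isHomeomorph_coronaMap_iff (hf : IsCoarseMap f) (hne : Nonempty Y → Nonempty X) :
    IsHomeomorph (coronaMap hf) ↔ IsCoarseEquivalence f := by
  have := isCompact_iff_compactSpace.1 (isCompact_HigsonCorona X)
  rw [isHomeomorph_iff_continuous_bijective, isCoarseEquivalence_iff hf.lsContinuous,
    ← coronaMap_injective_iff hf, ← coronaMap_surjective_iff hf hne]
  exact ⟨fun h => h.2, fun h => ⟨(coronaMap hf).continuous, h⟩⟩

end coronaMap

end LargeScale

theorem mainTheorem5 {X Y : Type*} [MetricSpace X] [ProperSpace X] [MetricSpace Y] [ProperSpace Y]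
    (f : X → Y) (hf : LargeScale.IsCoarseMap f) (hne : Nonempty Y → Nonempty X) :
    (Function.Injective (LargeScale.coronaMap hf) ↔ LargeScale.IsCoarseEmbedding f) ∧
    (Function.Surjective (LargeScale.coronaMap hf) ↔ LargeScale.CoarselySurjective f) ∧
    (IsHomeomorph (LargeScale.coronaMap hf) ↔ LargeScale.IsCoarseEquivalence f) :=
  ⟨LargeScale.coronaMap_injective_iff hf, LargeScale.coronaMap_surjective_iff hf hne,
    LargeScale.isHomeomorph_coronaMap_iff hf hne⟩
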